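/- Consider the 3-chain (bilocality) scenario with binary variables: Alice, Bob and Charlie have outputs $a,b,c\in\{0,1\}$, Alice and Charlie have inputs $x,z\in\{0,1\}$, Bob has no input; one source is shared by Alice and Bob, an independent one by Bob and Charlie. For correlations $p(a,b,c|x,z)$ define: * $\mathcal S_0$ (both sources classical): $p(a,b,c|x,z)=\int\!\!\int p_A(a|x,\lambda_1)\,p_B(b|\lambda_1,\lambda_2)\,p_C(c|z,\lambda_2)\,d\mu_1(\lambda_1)\,d\mu_2(\lambda_2)$ for probability measures $\mu_1,\mu_2$ and conditional probabilities $p_A,p_B,p_C$. * $\mathcal S_1^{[AB^OBC^L]}$: $p(a,b,c|x,z)=\int p_{AB}(a,b|x,\lambda)\,p_C(c|z,\lambda)\,d\mu(\lambda)$ for a probability measure $\mu$, a conditional probability $p_C$ and a bipartite no-signalling box $p_{AB}$ with inputs $x$ (Alice) and $\lambda$ (Bob). * $\mathcal S_1^{[AB^LBC^O]}$: $p(a,b,c|x,z)=\int p_A(a|x,\lambda)\,p_{BC}(b,c|\lambda,z)\,d\mu(\lambda)$ for a probability measure $\mu$, a conditional probability $p_A$ and a bipartite no-signalling box $p_{BC}$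 with inputs $\lambda$ (Bob) and $z$ (Charlie). * $\mathcal S_1^{\cap}=\mathcal S_1^{[AB^OBC^L]}\cap\mathcal S_1^{[AB^LBC^O]}$; the correlations in $\mathcal S_1^{\cap}\setminus\mathcal S_0$ are called minimally network nonclassical (MNN). * $\mathcal Q_2$ (quantumly realizable): $p(a,b,c|x,z)=\mathrm{Tr}\big[(\rho_{AB}\otimes\sigma_{B'C})(A_{a|x}\otimes B_b\otimes C_{c|z})\big]$ for density matrices $\rho_{AB}$, $\sigma_{B'C}$ on finite-dimensional spaces and POVMs $\{A_{a|x}\}_a$ on $A$, $\{B_b\}_b$ on $BB'$, $\{C_{c|z}\}_c$ on $C$. Let $|\phi^+\rangle=(|00\rangle+|11\rangle)/\sqrt2$ and $|\psi^+\rangle=(|01\rangle+|10\rangle)/\sqrt2$; for an observable with values $\pm1$, outcome $o$ stands for the value $(-1)^o$. * Let $p_{ES}$ be the correlation obtained when both sources emit $|\phi^+\rangle$, Alice measures $(\sigma_x-\sigma_z)/\sqrt2$ for $x=0$ and $(\sigma_x+\sigma_z)/\sqrt2$ for $x=1$, Charlie measures $\sigma_x$ for $z=0$ and $\sigma_z$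 for $z=1$, and Bob's measurement operators are $B_0=|\psi^+\rangle\langle\psi^+|$, $B_1=\mathbb 1-B_0$. * Let $p_L(a,b,c|x,z)=\tfrac12\,q(a,b|x,c)$, where $q(a,b|x,c)=\tfrac14$ if $x\ne c$, $q(a,b|x,c)=\tfrac12$ if $x=c$ and $a=b$, and $q(a,b|x,c)=0$ if $x=c$ and $a\neq b$. * For $\theta\in\mathbb R$ let $p^{(2)}_\theta$ be the correlation obtained when both sources emit $|\phi^+\rangle$, Alice and Charlie each measure $\sigma_x$ on input $0$ and $\sigma_z$ on input $1$, and Bob's measurement operators are $B_0=|\psi_\theta\rangle\langle\psi_\theta|$, $B_1=\mathbb 1-B_0$, where $|\psi_\theta\rangle=\sin\theta|01\rangle+\cos\theta|10\rangle$, the first qubit coming from the source shared with Alice. Then there are quantumly realizable MNN correlations, that is, $\mathcal Q_2\cap(\mathcal S_1^{\cap}\setminus\mathcal S_0)\neq\emptyset$. More precisely: 1. $p_{ES}(a,0,c|x,z)=\tfrac1{4}\cdot\tfrac14\big(1+\tfrac1{\sqrt2}(-1)^{a+c+xz}\big)$ and $p_{ES}(a,1,c|x,z)=\tfrac14-p_{ES}(a,0,c|x,z)$,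 and for every $\mu\in(0.455,0.705)$ the mixture $\mu\,p_{ES}+(1-\mu)\,p_L$ belongs to $\mathcal Q_2\cap(\mathcal S_1^{\cap}\setminus\mathcal S_0)$. 2. For every $\theta\in(0,\pi/4)\cup(\pi/4,\pi/2)$ the correlation $p^{(2)}_\theta$ belongs to $\mathcal Q_2\cap(\mathcal S_1^{\cap}\setminus\mathcal S_0)$. -/

import Mathlib

open MeasureTheory
open scoped Kronecker ComplexOrder

namespace ThreeChain

noncomputable section

/-- The common alphabet of all inputs and outputs. -/
abbrev Bit : Type := Fin 2

/-- A table of reals `p a b c x z`, read as `p(a,b,c|x,z)`: outputs `a`, `b`, `c` of Alice, Bob and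
Charlie, inputs `x`, `z` of Alice and Charlie; Bob has no input. -/
abbrev Corr : Type := Bit → Bit → Bit → Bit → Bit → ℝ

/-! ### Classical and no-signalling models -/

/-- `r o l` is a measurable conditional probability of the output `o` given the value `l` of a
classical hidden variable. -/
def IsResponse {O Λ : Type} [Fintype O] [MeasurableSpace Λ] (r : O → Λ → ℝ) : Prop :=
  (∀ o, Measurable (r o)) ∧ (∀ o l, 0 ≤ r o l) ∧ ∀ l, ∑ o, r o l = 1

/-- `N o₁ o₂ i₁ i₂`, read as `N(o₁,o₂|i₁,i₂)`, is a bipartite no-signalling box. -/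
def IsNoSignallingBox {O₁ O₂ I₁ I₂ : Type} [Fintype O₁] [Fintype O₂]
    (N : O₁ → O₂ → I₁ → I₂ → ℝ) : Prop :=
  (∀ o₁ o₂ i₁ i₂, 0 ≤ N o₁ o₂ i₁ i₂) ∧
  (∀ i₁ i₂, ∑ o₁, ∑ o₂, N o₁ o₂ i₁ i₂ = 1) ∧
  (∀ o₁ i₁ i₂ i₂', ∑ o₂, N o₁ o₂ i₁ i₂ = ∑ o₂, N o₁ o₂ i₁ i₂') ∧
  (∀ o₂ i₁ i₁' i₂, ∑ o₁, N o₁ o₂ i₁ i₂ = ∑ o₁, N o₁ o₂ i₁' i₂)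

/-- `𝒮₀`: both sources are classical (bilocal correlations). -/
def S0 : Set Corr :=
  {p | ∃ (Λ₁ Λ₂ : Type) (_ : MeasurableSpace Λ₁) (_ : MeasurableSpace Λ₂)
      (μ₁ : Measure Λ₁) (μ₂ : Measure Λ₂)
      (pA : Bit → Bit → Λ₁ → ℝ) (pB : Bit → Λ₁ × Λ₂ → ℝ) (pC : Bit → Bit → Λ₂ → ℝ),
      IsProbabilityMeasure μ₁ ∧ IsProbabilityMeasure μ₂ ∧
      (∀ x, IsResponse fun a => pA a x) ∧ IsResponse pB ∧ (∀ z, IsResponse fun c => pC c z) ∧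
      ∀ a b c x z, p a b c x z =
        ∫ l₁, ∫ l₂, pA a x l₁ * pB b (l₁, l₂) * pC c z l₂ ∂μ₂ ∂μ₁}

/-- `𝒮₁` with a no-signalling (OPT) source between Alice and Bob and a classical source between Bob
and Charlie; the value of the classical source is Bob's input to the no-signalling box. -/
def S1_ABO_BCL : Set Corr :=
  {p | ∃ (Λ : Type) (_ : MeasurableSpace Λ) (μ : Measure Λ)
      (N : Bit → Bit → Bit → Λ → ℝ) (pC : Bit → Bit → Λ → ℝ),
      IsProbabilityMeasure μ ∧
      (∀ a b x, Measurable (N a b x)) ∧ IsNoSignallingBox N ∧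
      (∀ z, IsResponse fun c => pC c z) ∧
      ∀ a b c x z, p a b c x z = ∫ l, N a b x l * pC c z l ∂μ}

/-- `𝒮₁` with a classical source between Alice and Bob and a no-signalling (OPT) source between Bob
and Charlie; the value of the classical source is Bob's input to the no-signalling box. -/
def S1_ABL_BCO : Set Corr :=
  {p | ∃ (Λ : Type) (_ : MeasurableSpace Λ) (μ : Measure Λ)
      (pA : Bit → Bit → Λ → ℝ) (N : Bit → Bit → Λ → Bit → ℝ),
      IsProbabilityMeasure μ ∧
      (∀ x, IsResponse fun a => pA a x) ∧
      (∀ b c z, Measurable fun l => N b c l z) ∧ IsNoSignallingBox N ∧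
      ∀ a b c x z, p a b c x z = ∫ l, pA a x l * N b c l z ∂μ}

/-- `𝒮₁^∩`. -/
def S1cap : Set Corr := S1_ABO_BCL ∩ S1_ABL_BCO

/-- The minimally network nonclassical correlations. -/
def MNN : Set Corr := S1cap \ S0

/-! ### Quantum models -/

/-- Density matrices. -/
def IsState {n : Type} [Fintype n] (ρ : Matrix n n ℂ) : Prop :=
  ρ.PosSemidef ∧ ρ.trace = 1

/-- Two-outcome POVMs. -/
def IsPOVM {n : Type} [Fintype n] [DecidableEq n] (M : Bit → Matrix n n ℂ) : Prop :=
  (∀ o, (M o).PosSemidef) ∧ ∑ o, M o = 1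

/-- Born rule for two independent sources: `ρ` is the state of Alice and Bob, `σ` the state of Bob
and Charlie, `A a x`, `B b`, `C c z` are the measurement operators, and the value is
`Tr[(ρ ⊗ σ) (A a x ⊗ B b ⊗ C c z)]`. The `submatrix` only rebrackets tensor factors. -/
def bornCorr {hA hB hB' hC : Type} [Fintype hA] [Fintype hB] [Fintype hB'] [Fintype hC]
    (ρ : Matrix (hA × hB) (hA × hB) ℂ) (σ : Matrix (hB' × hC) (hB' × hC) ℂ)
    (A : Bit → Bit → Matrix hA hA ℂ) (B : Bit → Matrix (hB × hB') (hB × hB') ℂ)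
    (C : Bit → Bit → Matrix hC hC ℂ) : Corr :=
  fun a b c x z =>
    (((ρ ⊗ₖ σ) * ((A a x ⊗ₖ B b) ⊗ₖ C c z).submatrix
      (fun i : (hA × hB) × (hB' × hC) => ((i.1.1, (i.1.2, i.2.1)), i.2.2))
      (fun i : (hA × hB) × (hB' × hC) => ((i.1.1, (i.1.2, i.2.1)), i.2.2))).trace).re

/-- `𝒬₂`: correlations realizable with two independent (finite-dimensional) quantum sources. -/
def Q2 : Set Corr :=
  {p | ∃ (hA hB hB' hC : Type) (_ : Fintype hA) (_ : Fintype hB) (_ : Fintype hB')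
      (_ : Fintype hC) (_ : DecidableEq hA) (_ : DecidableEq hB) (_ : DecidableEq hB')
      (_ : DecidableEq hC)
      (ρ : Matrix (hA × hB) (hA × hB) ℂ) (σ : Matrix (hB' × hC) (hB' × hC) ℂ)
      (A : Bit → Bit → Matrix hA hA ℂ) (B : Bit → Matrix (hB × hB') (hB × hB') ℂ)
      (C : Bit → Bit → Matrix hC hC ℂ),
      IsState ρ ∧ IsState σ ∧ (∀ x, IsPOVM fun a => A a x) ∧ IsPOVM B ∧
      (∀ z, IsPOVM fun c => C c z) ∧ p = bornCorr ρ σ A B C}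

/-! ### The two families of examples -/

def sigmaX : Matrix Bit Bit ℂ := !![0, 1; 1, 0]

def sigmaZ : Matrix Bit Bit ℂ := !![1, 0; 0, -1]

/-- The rank-one operator `|v⟩⟨v|`. -/
def ketbra {n : Type} (v : n → ℂ) : Matrix n n ℂ := Matrix.vecMulVec v (star v)

/-- Spectral projector of a `±1`-valued observable `O`; outcome `o` stands for the value `(-1)^o`. -/
def obsProj (O : Matrix Bit Bit ℂ) (o : Bit) : Matrix Bit Bit ℂ :=
  (1 / 2 : ℂ) • (1 + (-1 : ℂ) ^ o.val • O)

/-- The measurement `{|v⟩⟨v|, 1 - |v⟩⟨v|}`, with outcome `0` for `|v⟩⟨v|`. -/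
def vecMeas {n : Type} [DecidableEq n] (v : n → ℂ) (b : Bit) : Matrix n n ℂ :=
  if b = 0 then ketbra v else 1 - ketbra v

/-- `|φ⁺⟩ = (|00⟩ + |11⟩)/√2`. -/
def phiPlus : Bit × Bit → ℂ := fun i => if i.1 = i.2 then ((1 / √2 : ℝ) : ℂ) else 0

/-- `|ψ⁺⟩ = (|01⟩ + |10⟩)/√2`. -/
def psiPlus : Bit × Bit → ℂ := fun i => if i.1 = i.2 then 0 else ((1 / √2 : ℝ) : ℂ)

/-- `|ψ_θ⟩ = sin θ |01⟩ + cos θ |10⟩`. -/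
def psiTheta (θ : ℝ) : Bit × Bit → ℂ := fun i =>
  if i = (0, 1) then (Real.sin θ : ℂ) else if i = (1, 0) then (Real.cos θ : ℂ) else 0

/-- The observables `(σ_x - σ_z)/√2` (input `0`) and `(σ_x + σ_z)/√2` (input `1`). -/
def obsDiag (x : Bit) : Matrix Bit Bit ℂ :=
  ((1 / √2 : ℝ) : ℂ) • (if x = 0 then sigmaX - sigmaZ else sigmaX + sigmaZ)

/-- The observables `σ_x` (input `0`) and `σ_z` (input `1`). -/
def obsXZ (x : Bit) : Matrix Bit Bit ℂ := if x = 0 then sigmaX else sigmaZ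

/-- The entanglement-swapping correlation: both sources emit `|φ⁺⟩`, Bob tests for `|ψ⁺⟩`. -/
def pES : Corr :=
  bornCorr (ketbra phiPlus) (ketbra phiPlus) (fun a x => obsProj (obsDiag x) a)
    (vecMeas psiPlus) (fun c z => obsProj (obsXZ z) c)

/-- The noisy Popescu–Rohrlich box `(1 + V (-1)^(a + c + x z)) / 4`. -/
def prBox (V : ℝ) (a c x z : Bit) : ℝ :=
  (1 + V * (-1) ^ (a.val + c.val + x.val * z.val)) / 4

/-- The post-selection box with visibility `V` and post-selection probability `q`. -/
def pPS (V q : ℝ) : Corr := fun a b c x z =>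
  if b = 0 then q * prBox V a c x z else 1 / 4 - q * prBox V a c x z

/-- The local Bell test: Charlie outputs a uniform bit `c`, which is also Bob's setting. -/
def pL : Corr := fun a b c x _ =>
  1 / 2 * (if x = c then (if a = b then 1 / 2 else 0) else 1 / 4)

/-- The mixture of entanglement swapping and the local Bell test. -/
def pMNN1 (μ : ℝ) : Corr := μ • pES + (1 - μ) • pL

/-- Both sources emit `|φ⁺⟩`, Bob tests for `|ψ_θ⟩`, Alice and Charlie measure `σ_x` or `σ_z`. -/
def pMNN2 (θ : ℝ) : Corr :=
  bornCorr (ketbra phiPlus) (ketbra phiPlus) (fun a x => obsProj (obsXZ x) a)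
    (vecMeas (psiTheta θ)) (fun c z => obsProj (obsXZ z) c)

end

end ThreeChain

/-! Membership in `S1cap` is shown by explicit models. Since Alice's and Charlie's outputs are
jointly uniform in both families, the classical source is taken uniform on the other end party's
four deterministic strategies, and only the `b = 0` branch of the box has to be matched
(`mem_S1_ABO_BCL_of_uniform`). The opposite arrangement follows by `exchange`.

Exclusion from `S0` rests on `exists_unbiased_model_of_mem_S0`: the sources may distribute
deterministic strategies, and uniform outputs leave one parameter for each source, `u` and `v`. The
weight of a strategy pair together with `b = 0` is at most the product of the two strategy weights,
so linear constraints from the table meet a bound bilinear in `u`, `v`. For `pMNN2` the zeros of the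
table make the weights rigid and the product bound caps them at `1 / 16`; for `pMNN1` three bounds
combine into a quadratic inequality without admissible solutions.

For `Q2`, the mixture is realized by a flag inside the Bob–Charlie source, telling both of them
which experiment to perform (`bornCorr_flagged`). -/

namespace ThreeChain

noncomputable section

/-! ### Models with one classical source -/

/-- The answer to question `i` prescribed by a deterministic strategy. -/
def answer (l : Bit × Bit) (i : Bit) : Bit := if i = 0 then l.1 else l.2

/-- Exchange of the roles of Alice and Charlie. -/
def exchange (p : Corr) : Corr := fun a b c x z => p c b a z x

lemma mem_S1_ABL_BCO_of_exchange {p : Corr} (h : exchange p ∈ S1_ABO_BCL) :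
    p ∈ S1_ABL_BCO := by
  obtain ⟨Λ, mΛ, μ, N, pC, hμ, hN, ⟨h0, h1, h2, h3⟩, hC, hp⟩ := h
  refine ⟨Λ, mΛ, μ, pC, fun b c l z => N c b z l, hμ, hC, fun b c z => hN c b z,
    ⟨fun b c l z => h0 c b z l, fun l z => ?_, fun b l z z' => h3 b z z' l,
      fun c l l' z => h2 c z l l'⟩, fun a b c x z => ?_⟩
  · rw [Finset.sum_comm]; exact h1 z l
  · rw [show p a b c x z = exchange p c b a z x from rfl, hp]
    exact integral_congr_ae (Filter.Eventually.of_forall fun l => mul_comm _ _)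

/-- A classical source between Bob and Charlie that is uniform on Charlie's deterministic
strategies, with a no-signalling box of unbiased Alice marginal, reproduces `p` if the `b = 0`
branch matches. -/
lemma mem_S1_ABO_BCL_of_uniform {p : Corr} (g : Bit × Bit → ℝ) (d : Bit → Bit × Bit → ℝ)
    (hd : ∀ x l, |d x l| ≤ g l) (hd' : ∀ x l, g l + |d x l| ≤ 1)
    (hp₀ : ∀ a c x z, p a 0 c x z =
      1 / 4 * ∑ l, (g l + (-1) ^ a.val * d x l) / 2 * if answer l z = c then 1 else 0)
    (hp₁ : ∀ a c x z, p a 1 c x z = 1 / 4 - p a 0 c x z) : p ∈ S1_ABO_BCL := by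
  refine ⟨Bit × Bit, inferInstance, (PMF.uniformOfFintype (Bit × Bit)).toMeasure,
    fun a b x l => if b = 0 then (g l + (-1) ^ a.val * d x l) / 2 else
      1 / 2 - (g l + (-1) ^ a.val * d x l) / 2,
    fun c z l => if answer l z = c then 1 else 0, inferInstance,
    fun a b x => measurable_of_finite _, ⟨?_, ?_, ?_, ?_⟩, ?_, ?_⟩
  · intro a b x l
    have h1 := abs_le.1 (hd x l)
    have h2 := hd' x l
    have h3 := le_abs_self (d x l)
    have h4 := neg_abs_le (d x l)
    fin_cases a <;> fin_cases b <;> simp <;> linarith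
  · intro x l
    simp [Fin.sum_univ_two]
  · intro a x l l'
    simp [Fin.sum_univ_two]
  · intro b x x' l
    fin_cases b <;> simp [Fin.sum_univ_two] <;> ring
  · intro z
    refine ⟨fun c => measurable_of_finite _, fun c l => by positivity, fun l => by simp⟩
  · have hsum : ∀ c z : Bit, ∑ l : Bit × Bit, (if answer l z = c then (1 : ℝ) else 0) = 2 := by
      intro c z
      fin_cases c <;> fin_cases z <;>
        norm_num [answer, Fintype.sum_prod_type, Fin.sum_univ_two, -Finset.sum_boole]
    intro a b c x z
    rw [PMF.integral_eq_sum]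
    have hw : ∀ l : Bit × Bit, ((PMF.uniformOfFintype (Bit × Bit)) l).toReal = 1 / 4 := by
      intro l; simp
    simp only [hw, smul_eq_mul, ← Finset.mul_sum]
    have hb : b = 0 ∨ b = 1 := by fin_cases b <;> simp
    rcases hb with rfl | rfl
    · simpa using hp₀ a c x z
    · rw [hp₁, hp₀]
      simp only [one_ne_zero, if_false, sub_mul, Finset.sum_sub_distrib, ← Finset.mul_sum, hsum]
      ring

/-! ### Finite models of bilocal correlations -/

/-- The weight of a deterministic strategy with unbiased answers. -/
def stratWeight (u : ℝ) (l : Bit × Bit) : ℝ := if l.1 = l.2 then u else 1 / 2 - u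

lemma IsResponse.le_one {O Λ : Type} [Fintype O] [MeasurableSpace Λ] {r : O → Λ → ℝ}
    (h : IsResponse r) (o : O) (l : Λ) : r o l ≤ 1 := by
  rw [← h.2.2 l]
  exact Finset.single_le_sum (fun o _ => h.2.1 o l) (Finset.mem_univ o)

/-- A party's randomized response, written through deterministic strategies. -/
lemma sum_strategies {Λ : Type} [MeasurableSpace Λ] {r : Bit → Bit → Λ → ℝ}
    (h : ∀ x, IsResponse fun a => r a x) (a x : Bit) (l : Λ) :
    ∑ α : Bit × Bit, (if answer α x = a then r α.1 0 l * r α.2 1 l else 0) = r a x l := by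
  have h0 := (h 0).2.2 l
  have h1 := (h 1).2.2 l
  simp only [Fin.sum_univ_two] at h0 h1
  have e0 : r 1 0 l = 1 - r 0 0 l := by linarith
  have e1 : r 1 1 l = 1 - r 0 1 l := by linarith
  fin_cases a <;> fin_cases x <;>
    simp [answer, Fintype.sum_prod_type, Fin.sum_univ_two, e0, e1] <;> ring

lemma integrable_of_unit_bounds {Ω : Type} [MeasurableSpace Ω] {μ : Measure Ω}
    [IsFiniteMeasure μ] {f : Ω → ℝ} (hf : Measurable f) (h0 : ∀ ω, 0 ≤ f ω) (h1 : ∀ ω, f ω ≤ 1) :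
    Integrable f μ :=
  Integrable.of_bound hf.aestronglyMeasurable 1
    (Filter.Eventually.of_forall fun ω => by rw [Real.norm_of_nonneg (h0 ω)]; exact h1 ω)

/-- A bilocal correlation has a model in which the sources distribute deterministic strategies. -/
lemma exists_finite_model_of_mem_S0 {p : Corr} (hp : p ∈ S0) :
    ∃ (P Q : Bit × Bit → ℝ) (G : Bit → Bit × Bit → Bit × Bit → ℝ),
      (∀ α, 0 ≤ P α) ∧ (∀ γ, 0 ≤ Q γ) ∧ ∑ α, P α = 1 ∧ ∑ γ, Q γ = 1 ∧
      (∀ b α γ, 0 ≤ G b α γ) ∧ (∀ α γ, G 0 α γ + G 1 α γ = P α * Q γ) ∧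
      ∀ a b c x z, p a b c x z =
        ∑ α, ∑ γ, if answer α x = a ∧ answer γ z = c then G b α γ else 0 := by
  obtain ⟨Λ₁, Λ₂, m₁, m₂, μ₁, μ₂, pA, pB, pC, hμ₁, hμ₂, hA, hB, hC, hp⟩ := hp
  -- Given the hidden value, the answers to the two inputs are drawn independently; only one of them
  -- is ever read, so this coupling does no harm.
  set fA : Bit × Bit → Λ₁ → ℝ := fun α l => pA α.1 0 l * pA α.2 1 l with hfA
  set fC : Bit × Bit → Λ₂ → ℝ := fun γ l => pC γ.1 0 l * pC γ.2 1 l with hfC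
  have mA : ∀ α, Measurable (fA α) := fun α => ((hA 0).1 _).mul ((hA 1).1 _)
  have mC : ∀ γ, Measurable (fC γ) := fun γ => ((hC 0).1 _).mul ((hC 1).1 _)
  have nA : ∀ α l, 0 ≤ fA α l := fun α l => mul_nonneg ((hA 0).2.1 _ l) ((hA 1).2.1 _ l)
  have nC : ∀ γ l, 0 ≤ fC γ l := fun γ l => mul_nonneg ((hC 0).2.1 _ l) ((hC 1).2.1 _ l)
  have uA : ∀ α l, fA α l ≤ 1 := fun α l =>
    mul_le_one₀ ((hA 0).le_one _ l) ((hA 1).2.1 _ l) ((hA 1).le_one _ l)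
  have uC : ∀ γ l, fC γ l ≤ 1 := fun γ l =>
    mul_le_one₀ ((hC 0).le_one _ l) ((hC 1).2.1 _ l) ((hC 1).le_one _ l)
  have sA : ∀ l, ∑ α, fA α l = 1 := by
    intro l
    have h0 := (hA 0).2.2 l
    have h1 := (hA 1).2.2 l
    simp only [hfA, Fintype.sum_prod_type, ← Finset.mul_sum, h1, mul_one, h0]
  have sC : ∀ l, ∑ γ, fC γ l = 1 := by
    intro l
    have h0 := (hC 0).2.2 l
    have h1 := (hC 1).2.2 l
    simp only [hfC, Fintype.sum_prod_type, ← Finset.mul_sum, h1, mul_one, h0]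
  have iA : ∀ α, Integrable (fA α) μ₁ := fun α => integrable_of_unit_bounds (mA α) (nA α) (uA α)
  have iC : ∀ γ, Integrable (fC γ) μ₂ := fun γ => integrable_of_unit_bounds (mC γ) (nC γ) (uC γ)
  set F : Bit → Bit × Bit → Bit × Bit → Λ₁ × Λ₂ → ℝ :=
    fun b α γ l => fA α l.1 * pB b l * fC γ l.2 with hF
  have iF : ∀ b α γ, Integrable (F b α γ) (μ₁.prod μ₂) := fun b α γ =>
    integrable_of_unit_bounds
      ((((mA α).comp measurable_fst).mul (hB.1 b)).mul ((mC γ).comp measurable_snd))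
      (fun l => mul_nonneg (mul_nonneg (nA _ _) (hB.2.1 _ _)) (nC _ _))
      (fun l => mul_le_one₀ (mul_le_one₀ (uA _ _) (hB.2.1 _ _) (hB.le_one _ _)) (nC _ _) (uC _ _))
  refine ⟨fun α => ∫ l, fA α l ∂μ₁, fun γ => ∫ l, fC γ l ∂μ₂,
    fun b α γ => ∫ l, F b α γ l ∂(μ₁.prod μ₂), fun α => integral_nonneg (nA α),
    fun γ => integral_nonneg (nC γ), ?_, ?_, ?_, ?_, ?_⟩
  · rw [← integral_finsetSum _ fun α _ => iA α]; simp [sA]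
  · rw [← integral_finsetSum _ fun γ _ => iC γ]; simp [sC]
  · exact fun b α γ => integral_nonneg fun l =>
      mul_nonneg (mul_nonneg (nA _ _) (hB.2.1 _ _)) (nC _ _)
  · intro α γ
    rw [← integral_add (iF 0 α γ) (iF 1 α γ), ← integral_prod_mul]
    refine integral_congr_ae (Filter.Eventually.of_forall fun l => ?_)
    have := hB.2.2 l
    simp only [Fin.sum_univ_two] at this
    simp only [hF]
    linear_combination fA α l.1 * fC γ l.2 * this
  · intro a b c x z
    have hpt : ∀ l : Λ₁ × Λ₂, pA a x l.1 * pB b l * pC c z l.2 =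
        ∑ α, ∑ γ, if answer α x = a ∧ answer γ z = c then F b α γ l else 0 := by
      intro l
      rw [← sum_strategies hA a x l.1, ← sum_strategies hC c z l.2, Finset.sum_mul,
        Finset.sum_mul_sum]
      refine Finset.sum_congr rfl fun α _ => Finset.sum_congr rfl fun γ _ => ?_
      simp only [ite_and, ite_mul, mul_ite, zero_mul, mul_zero, hF, hfA, hfC]
      split_ifs <;> rfl
    have iF' : ∀ α γ, Integrable (fun l => if answer α x = a ∧ answer γ z = c then F b α γ l else 0)
        (μ₁.prod μ₂) := by
      intro α γ
      split_ifs
      · exact iF b α γ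
      · exact integrable_zero _ _ _
    have hint : Integrable (fun l : Λ₁ × Λ₂ => pA a x l.1 * pB b l * pC c z l.2) (μ₁.prod μ₂) := by
      simp only [hpt]
      exact integrable_finsetSum _ fun α _ => integrable_finsetSum _ fun γ _ => iF' α γ
    rw [hp, ← integral_prod (fun l : Λ₁ × Λ₂ => pA a x l.1 * pB b l * pC c z l.2) hint]
    simp only [hpt]
    rw [integral_finsetSum _ fun α _ => integrable_finsetSum _ fun γ _ => iF' α γ]
    refine Finset.sum_congr rfl fun α _ => ?_
    rw [integral_finsetSum _ fun γ _ => iF' α γ]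
    refine Finset.sum_congr rfl fun γ _ => ?_
    split_ifs <;> simp

/-- If Alice and Charlie have jointly uniform outputs, the strategy weights have one free
parameter each. -/
lemma exists_unbiased_model_of_mem_S0 {p : Corr} (hp : p ∈ S0)
    (hu : ∀ a c x z, p a 0 c x z + p a 1 c x z = 1 / 4) :
    ∃ (u v : ℝ) (G : Bit × Bit → Bit × Bit → ℝ),
      0 ≤ u ∧ u ≤ 1 / 2 ∧ 0 ≤ v ∧ v ≤ 1 / 2 ∧ (∀ α γ, 0 ≤ G α γ) ∧
      (∀ α γ, G α γ ≤ stratWeight u α * stratWeight v γ) ∧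
      ∀ a c x z, p a 0 c x z =
        ∑ α, ∑ γ, if answer α x = a ∧ answer γ z = c then G α γ else 0 := by
  obtain ⟨P, Q, G, hP, hQ, sP, sQ, hG, hGs, hpG⟩ := exists_finite_model_of_mem_S0 hp
  have key : ∀ a c x z, (∑ α, if answer α x = a then P α else 0) *
      (∑ γ, if answer γ z = c then Q γ else 0) = 1 / 4 := by
    intro a c x z
    rw [← hu a c x z, hpG, hpG, ← Finset.sum_add_distrib, Finset.sum_mul_sum]
    refine Finset.sum_congr rfl fun α _ => ?_
    rw [← Finset.sum_add_distrib]
    refine Finset.sum_congr rfl fun γ _ => ?_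
    by_cases h1 : answer α x = a <;> by_cases h2 : answer γ z = c <;> simp [h1, h2, hGs]
  have k00 := key 0 0 0 0
  have k01 := key 0 1 0 0
  have k10 := key 1 0 0 0
  have k0' := key 0 0 1 0
  have k1' := key 0 1 1 0
  have k0'' := key 0 0 0 1
  have k1'' := key 1 0 0 1
  simp [Fintype.sum_prod_type, Fin.sum_univ_two, answer] at k00 k01 k10 k0' k1' k0'' k1'' sP sQ
  -- Adding over Charlie's output leaves Alice's marginal, which is `1 / 2` for either input; `hQ1`
  -- and `hQ2` do the same for Charlie.
  have hP1 : P (0, 0) + P (0, 1) = 1 / 2 := by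
    linear_combination k00 + k01 - (P (0, 0) + P (0, 1)) * sQ
  have hP2 : P (0, 0) + P (1, 0) = 1 / 2 := by
    linear_combination k0' + k1' - (P (0, 0) + P (1, 0)) * sQ
  have hQ1 : Q (0, 0) + Q (0, 1) = 1 / 2 := by
    linear_combination k00 + k10 - (Q (0, 0) + Q (0, 1)) * sP
  have hQ2 : Q (0, 0) + Q (1, 0) = 1 / 2 := by
    linear_combination k0'' + k1'' - (Q (0, 0) + Q (1, 0)) * sP
  have wP : ∀ α, P α = stratWeight (P (0, 0)) α := by
    rintro ⟨i, j⟩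
    fin_cases i <;> fin_cases j <;> simp [stratWeight] <;> linarith
  have wQ : ∀ γ, Q γ = stratWeight (Q (0, 0)) γ := by
    rintro ⟨i, j⟩
    fin_cases i <;> fin_cases j <;> simp [stratWeight] <;> linarith
  refine ⟨P (0, 0), Q (0, 0), G 0, hP _, by linarith [hP (0, 1)], hQ _, by linarith [hQ (0, 1)],
    hG 0, fun α γ => ?_, fun a c x z => hpG a 0 c x z⟩
  rw [← wP, ← wQ, ← hGs]
  linarith [hG 1 α γ]

/-! ### The family with Bob's vector tilted -/

/-- The table of entanglement swapping with Bob's vector `s |01⟩ + c |10⟩`, where `s² + c² = 1`. -/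
def tilted (s c : ℝ) : Corr := fun a b k x z =>
  let r := (1 + (if x = 0 then 0 else (-1) ^ a.val * (s ^ 2 - c ^ 2)) +
    (if z = 0 then 0 else (-1) ^ k.val * (c ^ 2 - s ^ 2)) +
    (if x = z then (if x = 0 then 2 * s * c else -1) * (-1) ^ (a.val + k.val) else 0)) / 16
  if b = 0 then r else 1 / 4 - r

lemma tilted_one (s c : ℝ) (a k x z : Bit) :
    tilted s c a 1 k x z = 1 / 4 - tilted s c a 0 k x z := by
  simp [tilted]

lemma exchange_tilted (s c : ℝ) : exchange (tilted s c) = tilted c s := by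
  funext a b k x z
  fin_cases x <;> fin_cases z <;> simp [exchange, tilted] <;> ring_nf

lemma tilted_mem_S1_ABO_BCL {s c : ℝ} (hs : 0 ≤ s) (hc : 0 ≤ c) (h : s ^ 2 + c ^ 2 = 1) :
    tilted s c ∈ S1_ABO_BCL := by
  have hsc : 2 * s * c ≤ 1 := by nlinarith [sq_nonneg (s - c)]
  have hsc0 : 0 ≤ 2 * s * c := by positivity
  have hs1 : s ^ 2 ≤ 1 := by nlinarith
  have hc1 : c ^ 2 ≤ 1 := by nlinarith
  have habs : |c| ≤ 1 := by rw [abs_of_nonneg hc]; nlinarith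
  have hs0 := sq_nonneg s
  have hc0 := sq_nonneg c
  have h1 : s ^ 2 * (2 * s * c) ≤ s ^ 2 := mul_le_of_le_one_right hs0 hsc
  have h2 : c ^ 2 * (2 * s * c) ≤ c ^ 2 := mul_le_of_le_one_right hc0 hsc
  have h3 : 0 ≤ s ^ 2 * (2 * s * c) := by positivity
  have h4 : 0 ≤ c ^ 2 * (2 * s * c) := by positivity
  -- Given `b = 0`, Alice's answer to `σ_z` is opposite to Charlie's, and her answer to `σ_x` has
  -- correlation `2 * s * c` with his. Bob's probability of `b = 0` depends only on Charlie's `σ_z`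
  -- bit, with weights `c ^ 2` and `s ^ 2`.
  refine mem_S1_ABO_BCL_of_uniform (fun l => if l.2 = 0 then c ^ 2 / 2 else s ^ 2 / 2)
    (fun x l => (if l.2 = 0 then c ^ 2 / 2 else s ^ 2 / 2) *
      (if x = 0 then (-1) ^ l.1.val * (2 * s * c) else -(-1) ^ l.2.val)) ?_ ?_ ?_ (tilted_one s c)
  · rintro x ⟨i, j⟩
    rw [abs_le]
    fin_cases x <;> fin_cases i <;> fin_cases j <;> constructor <;> simp <;> linarith
  · rintro x ⟨i, j⟩
    rw [← le_sub_iff_add_le', abs_le]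
    fin_cases x <;> fin_cases i <;> fin_cases j <;> constructor <;> simp <;> linarith
  · intro a k x z
    have e : c ^ 2 = 1 - s ^ 2 := by linarith
    fin_cases a <;> fin_cases k <;> fin_cases x <;> fin_cases z <;>
      simp [tilted, answer, Fintype.sum_prod_type, Fin.sum_univ_two, e] <;> ring

lemma tilted_mem_S1cap {s c : ℝ} (hs : 0 ≤ s) (hc : 0 ≤ c) (h : s ^ 2 + c ^ 2 = 1) :
    tilted s c ∈ S1cap :=
  ⟨tilted_mem_S1_ABO_BCL hs hc h, mem_S1_ABL_BCO_of_exchange (by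
    rw [exchange_tilted]; exact tilted_mem_S1_ABO_BCL hc hs (by linarith))⟩

/-- Replacing the larger of `u`, `v` by the smaller one, `t`, weakens one of the two bounds to `t *
(1 / 2 - t)`, whose maximum is `1 / 16`. -/
lemma le_sixteenth_of_le_stratWeight {u v k : ℝ} (hu0 : 0 ≤ u) (hv0 : 0 ≤ v)
    (h1 : k ≤ u * (1 / 2 - v)) (h2 : k ≤ (1 / 2 - u) * v) : k ≤ 1 / 16 := by
  rcases le_total u v with h | h
  · nlinarith [sq_nonneg (u - 1 / 4), mul_nonneg hu0 (sub_nonneg.2 h)]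
  · nlinarith [sq_nonneg (v - 1 / 4), mul_nonneg hv0 (sub_nonneg.2 h)]

/-- The surviving weights form two 2×2 tables with all row and column sums `s ^ 2 / 8`, respectively
`c ^ 2 / 8`. Let `e` and `f` be their repeated diagonal entries. Input `x = z = 0` gives `e + f = (1
+ 2 * s * c) / 16`, while both are at most `1 / 16`, so both are at least `s * c / 8`. But `e ≤ s ^
2 / 8` and `f ≤ c ^ 2 / 8`, which forces `s = c`. -/
lemma tilted_notMem_S0 {s c : ℝ} (hs : 0 < s) (hc : 0 < c) (h : s ^ 2 + c ^ 2 = 1) (hne : s ≠ c) :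
    tilted s c ∉ S0 := by
  intro hmem
  obtain ⟨u, v, G, hu0, hu, hv0, hv, hG0, hG, hp⟩ := exists_unbiased_model_of_mem_S0 hmem
    (fun a k x z => by rw [tilted_one]; ring)
  simp only [Fintype.sum_prod_type, Fin.sum_univ_two] at hp
  have e0000 := hp 0 0 0 0
  have e0001 := hp 0 0 0 1
  have e0010 := hp 0 0 1 0
  have e0011 := hp 0 0 1 1
  have e0100 := hp 0 1 0 0
  have e0101 := hp 0 1 0 1
  have e0110 := hp 0 1 1 0
  have e0111 := hp 0 1 1 1
  have e1000 := hp 1 0 0 0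
  have e1001 := hp 1 0 0 1
  have e1010 := hp 1 0 1 0
  have e1011 := hp 1 0 1 1
  have e1100 := hp 1 1 0 0
  have e1101 := hp 1 1 0 1
  have e1110 := hp 1 1 1 0
  have e1111 := hp 1 1 1 1
  clear hp
  simp [tilted, answer] at e0000 e0001 e0010 e0011 e0100 e0101 e0110 e0111
  simp [tilted, answer] at e1000 e1001 e1010 e1011 e1100 e1101 e1110 e1111
  -- At `x = z = 1` equal outputs never occur with `b = 0`, so nonnegative weights sum to zero.
  have hz : ∀ i j k, G (i, k) (j, k) = 0 := by
    intro i j k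
    have := hG0 (0, 0) (0, 0)
    have := hG0 (0, 0) (1, 0)
    have := hG0 (1, 0) (0, 0)
    have := hG0 (1, 0) (1, 0)
    have := hG0 (0, 1) (0, 1)
    have := hG0 (0, 1) (1, 1)
    have := hG0 (1, 1) (0, 1)
    have := hG0 (1, 1) (1, 1)
    fin_cases i <;> fin_cases j <;> fin_cases k <;> simp <;> linarith
  simp only [hz] at *
  have b1 : G (0, 0) (0, 1) ≤ 1 / 16 := by
    have g1 := hG (0, 0) (0, 1)
    have g2 := hG (1, 0) (1, 1)
    simp [stratWeight] at g1 g2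
    refine le_sixteenth_of_le_stratWeight hu0 hv0 (by linarith) ?_
    -- A 2×2 table with equal row and column sums has equal diagonal entries.
    have : G (0, 0) (0, 1) = G (1, 0) (1, 1) := by linarith
    linarith
  have b2 : G (0, 1) (0, 0) ≤ 1 / 16 := by
    have g1 := hG (0, 1) (0, 0)
    have g2 := hG (1, 1) (1, 0)
    simp [stratWeight] at g1 g2
    refine le_sixteenth_of_le_stratWeight hu0 hv0 ?_ (by linarith)
    have : G (0, 1) (0, 0) = G (1, 1) (1, 0) := by linarith
    linarith
  rcases lt_or_gt_of_ne hne with hlt | hlt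
  · have : s ^ 2 ≥ s * c := by linarith [hG0 (0, 0) (1, 1), hG0 (1, 0) (0, 1)]
    nlinarith
  · have : c ^ 2 ≥ s * c := by linarith [hG0 (0, 1) (1, 0), hG0 (1, 1) (0, 0)]
    nlinarith

/-! ### The mixture with the local Bell test -/

/-- The mixture of a post-selected noisy PR box with visibility `V` and the local Bell test. -/
def mixed (V μ : ℝ) : Corr := μ • pPS V (1 / 4) + (1 - μ) • pL

lemma mixed_zero (V μ : ℝ) (a c x z : Bit) : mixed V μ a 0 c x z =
    μ * (1 + V * (-1) ^ (a.val + c.val + x.val * z.val)) / 16 +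
      (1 - μ) * (1 / 2 * (if x = c then (if a = 0 then 1 / 2 else 0) else 1 / 4)) := by
  simp [mixed, pPS, pL, prBox]; ring

lemma mixed_one (V μ : ℝ) (a c x z : Bit) :
    mixed V μ a 1 c x z = 1 / 4 - mixed V μ a 0 c x z := by
  simp only [mixed, pPS, pL, prBox, Pi.add_apply, Pi.smul_apply, smul_eq_mul]
  fin_cases a <;> by_cases h : x = c <;> simp [h] <;> ring

lemma mixed_mem_S1_ABO_BCL {V μ : ℝ} (hV : 1 / 2 ≤ V) (hV1 : V ≤ 1) (hμ : 0 ≤ μ)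
    (h : μ * V ≤ 1 / 2) : mixed V μ ∈ S1_ABO_BCL := by
  have h1 : μ * V ≤ μ := mul_le_of_le_one_right hμ hV1
  have h2 : μ / 2 ≤ μ * V := by nlinarith
  have hμ1 : μ ≤ 1 := by linarith
  -- The table fixes `g` and each `d x` up to a multiple of the parity `(-1) ^ (l.1 + l.2)`; the
  -- multiples are chosen to keep the box nonnegative. The condition `μ * V ≤ 1 / 2` is exactly `-g
  -- ≤ d 1` at `l = (1, 0)`.
  refine mem_S1_ABO_BCL_of_uniform
    (fun l => if l.1 = l.2 then (1 - μ + μ * V) / 2 else (1 - μ * V) / 2)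
    (fun x l => if x = 0 then
      (if l.1 = l.2 then (-1) ^ l.1.val * (1 - μ + μ * V) / 2 else (1 - μ) / 2) else
      (if l = (0, 0) then μ * V - 1 / 2 else if l = (0, 1) then (1 - μ * V) / 2 else
        if l = (1, 0) then 1 / 2 - 3 / 2 * (μ * V) else 1 / 2 + μ * V - μ)) ?_ ?_ ?_ (mixed_one V μ)
  · rintro x ⟨i, j⟩
    rw [abs_le]
    fin_cases x <;> fin_cases i <;> fin_cases j <;> constructor <;> simp <;> linarith
  · rintro x ⟨i, j⟩
    rw [← le_sub_iff_add_le', abs_le]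
    fin_cases x <;> fin_cases i <;> fin_cases j <;> constructor <;> simp <;> linarith
  · intro a c x z
    rw [mixed_zero]
    fin_cases a <;> fin_cases c <;> fin_cases x <;> fin_cases z <;>
      simp [answer, Fintype.sum_prod_type, Fin.sum_univ_two] <;> ring

lemma mixed_mem_S1_ABL_BCO {V μ : ℝ} (hV : 1 / 2 ≤ V) (hV1 : V ≤ 1) (hμ : 0 ≤ μ)
    (h : μ * V ≤ 1 / 2) : mixed V μ ∈ S1_ABL_BCO := by
  have h1 : μ * V ≤ μ := mul_le_of_le_one_right hμ hV1
  have h2 : μ / 2 ≤ μ * V := by nlinarith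
  have hμ1 : μ ≤ 1 := by linarith
  -- The mixture is not symmetric between Alice and Charlie, so this side needs its own witnesses.
  -- Here `μ * V ≤ 1 / 2` is `d 0 ≤ g` at `l = (0, 0)`.
  refine mem_S1_ABL_BCO_of_exchange (mem_S1_ABO_BCL_of_uniform
    (fun l => if l = (0, 0) then 1 - μ * V / 2 - μ / 2 else if l = (1, 1) then (μ - μ * V) / 2 else
      (1 - μ + μ * V) / 2)
    (fun x l => if x = 0 then
      (if l = (0, 0) then (3 * (μ * V) - μ) / 2 else if l = (0, 1) then 1 / 2 - μ * V else
        if l = (1, 0) then μ - μ * V - 1 / 2 else (μ * V - μ) / 2) else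
      (if l = (0, 1) then (1 - μ + μ * V) / 2 else if l = (1, 0) then -(1 - μ + μ * V) / 2 else 0))
    ?_ ?_ ?_ fun a c x z => mixed_one V μ c a z x)
  · rintro x ⟨i, j⟩
    rw [abs_le]
    fin_cases x <;> fin_cases i <;> fin_cases j <;> constructor <;> simp <;> linarith
  · rintro x ⟨i, j⟩
    rw [← le_sub_iff_add_le', abs_le]
    fin_cases x <;> fin_cases i <;> fin_cases j <;> constructor <;> simp <;> linarith
  · intro a c x z
    rw [exchange, mixed_zero]
    fin_cases a <;> fin_cases c <;> fin_cases x <;> fin_cases z <;>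
      simp [answer, Fintype.sum_prod_type, Fin.sum_univ_two] <;> ring

/-- Three inequalities that every unbiased bilocal model of the mixture satisfies. -/
lemma exists_bounds_of_mixed_mem_S0 {V μ : ℝ} (h : mixed V μ ∈ S0) :
    ∃ p q : ℝ, 0 ≤ p ∧ p ≤ 2 ∧ p ≤ 1 + μ * (1 - V) ∧
      2 - 3 * (μ * (1 - V)) ≤ p * q ∧ μ * (3 * V - 1) ≤ (2 - p) * (2 - q) := by
  obtain ⟨u, v, G, hu0, hu, hv0, hv, hG0, hG, hp⟩ := exists_unbiased_model_of_mem_S0 h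
    (fun a k x z => by rw [mixed_one]; ring)
  simp only [mixed_zero, Fintype.sum_prod_type, Fin.sum_univ_two] at hp
  have e0000 := hp 0 0 0 0
  have e0001 := hp 0 0 0 1
  have e0010 := hp 0 0 1 0
  have e0011 := hp 0 0 1 1
  have e0100 := hp 0 1 0 0
  have e0101 := hp 0 1 0 1
  have e0110 := hp 0 1 1 0
  have e0111 := hp 0 1 1 1
  have e1000 := hp 1 0 0 0
  have e1001 := hp 1 0 0 1
  have e1010 := hp 1 0 1 0
  have e1011 := hp 1 0 1 1
  have e1100 := hp 1 1 0 0
  have e1101 := hp 1 1 0 1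
  have e1110 := hp 1 1 1 0
  have e1111 := hp 1 1 1 1
  clear hp
  simp [answer] at e0000 e0001 e0010 e0011 e0100 e0101 e0110 e0111
  simp [answer] at e1000 e1001 e1010 e1011 e1100 e1101 e1110 e1111
  simp only [Prod.forall, Fin.forall_fin_two, stratWeight] at hG hG0
  simp at hG
  obtain ⟨⟨⟨⟨_, _⟩, _, _⟩, ⟨_, _⟩, _, _⟩, ⟨⟨_, _⟩, _, _⟩, ⟨_, _⟩, _, _⟩ := hG
  obtain ⟨⟨⟨⟨_, _⟩, _, _⟩, ⟨_, _⟩, _, _⟩, ⟨⟨_, _⟩, _, _⟩, ⟨_, _⟩, _, _⟩ := hG0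
  -- With this scaling `p * q = 16 * (1 / 2 - u) * v` and `(2 - p) * (2 - q) = 16 * u * (1 / 2 - v)`
  -- are scaled products of strategy weights, so the claims are linear in `u`, `v`, `u * v` and the
  -- weights `G`.
  refine ⟨2 - 4 * u, 4 * v, by linarith, by linarith, ?_, ?_, ?_⟩
  all_goals linarith

/-- The quadratic is concave in `p`. For `d ≤ 0.18` its vertex lies beyond `1 + d`, where its value
is `-d * (8.828 * d - 1.172) < 0`; this is what needs the lower bound on `d`. For `d ≥ 0.18` its
discriminant is negative. -/
lemma bounds_inconsistent {d p : ℝ} (hd0 : 0.1332 < d) (hd1 : d < 0.2066) (hpd : p ≤ 1 + d)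
    (h : 0 ≤ -2 * p ^ 2 + (6 - 6.828 * d) * p - 4 + 6 * d) : False := by
  rcases le_total d 0.18 with hd | hd
  · have h1 : 0 ≤ (2 - 10.828 * d) * (1 + d - p) :=
      mul_nonneg (by linarith) (by linarith)
    have h2 : 0 < d * (8.828 * d - 1.172) := mul_pos (by linarith) (by linarith)
    nlinarith [sq_nonneg (p - 1 - d)]
  · have h1 : 0 ≤ (d - 0.18) * (0.2066 - d) := mul_nonneg (by linarith) (by linarith)
    nlinarith [sq_nonneg (4 * p - (6 - 6.828 * d))]

lemma one_div_sqrt_two_bounds : 0.7071 < 1 / √2 ∧ 1 / √2 < 0.7072 := by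
  have h : (√2) ^ 2 = 2 := Real.sq_sqrt (by norm_num)
  have h0 : 0 < √2 := by positivity
  constructor
  · rw [lt_div_iff₀ h0]; nlinarith
  · rw [div_lt_iff₀ h0]; nlinarith

lemma mixed_notMem_S0 {μ : ℝ} (h0 : 0.455 < μ) (h1 : μ < 0.705) : mixed (1 / √2) μ ∉ S0 := by
  intro h
  obtain ⟨p, q, hp0, hp2, hpd, hX, hY⟩ := exists_bounds_of_mixed_mem_S0 h
  obtain ⟨hV0, hV1⟩ := one_div_sqrt_two_bounds
  generalize 1 / √2 = V at *
  -- At `V = 1 / √2` one has `3 * V - 1 = (1 + 2 * √2) * (1 - V)`, and `3.828` is just below `1 + 2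
  -- * √2`.
  have hκ : 0 ≤ p * (μ * (3 * V - 1) - 3.828 * (μ * (1 - V))) := by
    refine mul_nonneg hp0 ?_
    have : 0 ≤ μ * (6.828 * V - 4.828) := mul_nonneg (by linarith) (by linarith)
    linarith
  refine bounds_inconsistent (d := μ * (1 - V)) (p := p) (by nlinarith) (by nlinarith) hpd ?_
  -- Weighting the two product bounds by `p` and `2 - p` eliminates `q`.
  have e1 := mul_nonneg hp0 (sub_nonneg.2 hY)
  have e2 := mul_nonneg (sub_nonneg.2 hp2) (sub_nonneg.2 hX)
  linarith

lemma mixed_mem_MNN {μ : ℝ} (h0 : 0.455 < μ) (h1 : μ < 0.705) : mixed (1 / √2) μ ∈ MNN := by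
  obtain ⟨hV0, hV1⟩ := one_div_sqrt_two_bounds
  have h : μ * (1 / √2) ≤ 1 / 2 := by nlinarith
  exact ⟨⟨mixed_mem_S1_ABO_BCL (by linarith) (by linarith) (by linarith) h,
    mixed_mem_S1_ABL_BCO (by linarith) (by linarith) (by linarith) h⟩, mixed_notMem_S0 h0 h1⟩

/-! ### Quantum states and measurements -/

open Matrix

lemma posSemidef_of_isHermitian_of_idempotent {n : Type} [Fintype n] {M : Matrix n n ℂ}
    (h : M.IsHermitian) (h' : M * M = M) : M.PosSemidef := by
  have := posSemidef_conjTranspose_mul_self M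
  rwa [h.eq, h'] at this

lemma ketbra_posSemidef {n : Type} [Fintype n] (v : n → ℂ) : (ketbra v).PosSemidef :=
  posSemidef_vecMulVec_self_star v

lemma isState_ketbra {n : Type} [Fintype n] {v : n → ℂ} (h : v ⬝ᵥ star v = 1) :
    IsState (ketbra v) :=
  ⟨ketbra_posSemidef v, by rw [ketbra, trace_vecMulVec, h]⟩

lemma isPOVM_vecMeas {n : Type} [Fintype n] [DecidableEq n] {v : n → ℂ} (h : v ⬝ᵥ star v = 1) :
    IsPOVM (vecMeas v) := by
  have hi : ketbra v * ketbra v = ketbra v := by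
    rw [ketbra, vecMulVec_mul_vecMulVec, dotProduct_comm, h, one_smul]
  have hh := (ketbra_posSemidef v).isHermitian
  refine ⟨fun o => ?_, ?_⟩
  · rw [vecMeas]
    split_ifs
    · exact ketbra_posSemidef v
    · refine posSemidef_of_isHermitian_of_idempotent (isHermitian_one.sub hh) ?_
      rw [sub_mul, mul_sub, mul_sub, hi]; simp
  · simp [Fin.sum_univ_two, vecMeas]

lemma isPOVM_obsProj {O : Matrix Bit Bit ℂ} (h : O.IsHermitian) (h' : O * O = 1) :
    IsPOVM (obsProj O) := by
  refine ⟨fun o => posSemidef_of_isHermitian_of_idempotent ?_ ?_, ?_⟩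
  · fin_cases o <;> simp [obsProj, IsHermitian, h.eq]
  · fin_cases o <;> simp [obsProj, mul_add, add_mul, h', smul_smul] <;> module
  · simp [obsProj, Fin.sum_univ_two]; module

lemma isPOVM_obsProj_obsXZ (x : Bit) : IsPOVM (obsProj (obsXZ x)) := by
  refine isPOVM_obsProj ?_ ?_
  · ext i j
    fin_cases x <;> fin_cases i <;> fin_cases j <;> simp [obsXZ, sigmaX, sigmaZ]
  · ext i j
    fin_cases x <;> fin_cases i <;> fin_cases j <;> simp [obsXZ, sigmaX, sigmaZ]

lemma one_div_sqrt_two_mul_self : 1 / √2 * (1 / √2) = (1 / 2 : ℝ) := by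
  rw [div_mul_div_comm, Real.mul_self_sqrt (by norm_num), one_mul]

lemma ofReal_one_div_sqrt_two_mul_self : ((1 / √2 : ℝ) : ℂ) * ((1 / √2 : ℝ) : ℂ) = 1 / 2 := by
  rw [← Complex.ofReal_mul, one_div_sqrt_two_mul_self]; norm_num

lemma isPOVM_obsProj_obsDiag (x : Bit) : IsPOVM (obsProj (obsDiag x)) := by
  have h := ofReal_one_div_sqrt_two_mul_self
  refine isPOVM_obsProj ?_ ?_
  · ext i j
    fin_cases x <;> fin_cases i <;> fin_cases j <;> simp [obsDiag, sigmaX, sigmaZ]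
  · rw [obsDiag]
    generalize ((1 / √2 : ℝ) : ℂ) = r at h
    ext i j
    fin_cases x <;> fin_cases i <;> fin_cases j <;>
      simp [sigmaX, sigmaZ, mul_apply, Fin.sum_univ_two] <;> linear_combination 2 * h

lemma phiPlus_norm : phiPlus ⬝ᵥ star phiPlus = 1 := by
  have h := ofReal_one_div_sqrt_two_mul_self
  simp only [dotProduct, phiPlus, Pi.star_apply, Fintype.sum_prod_type, Fin.sum_univ_two,
    apply_ite star, star_zero, RCLike.star_def, Complex.conj_ofReal]
  simp only [h, if_true, if_false, zero_ne_one, one_ne_zero, mul_zero]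
  norm_num

lemma psiPlus_norm : psiPlus ⬝ᵥ star psiPlus = 1 := by
  have h := ofReal_one_div_sqrt_two_mul_self
  simp only [dotProduct, psiPlus, Pi.star_apply, Fintype.sum_prod_type, Fin.sum_univ_two,
    apply_ite star, star_zero, RCLike.star_def, Complex.conj_ofReal]
  simp only [h, if_true, if_false, zero_ne_one, one_ne_zero, mul_zero]
  norm_num

lemma psiTheta_norm (θ : ℝ) : psiTheta θ ⬝ᵥ star (psiTheta θ) = 1 := by
  simp only [dotProduct, psiTheta, Pi.star_apply, Fintype.sum_prod_type, Fin.sum_univ_two]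
  simp only [apply_ite star, RCLike.star_def, Complex.ofReal_sin, Complex.ofReal_cos]
  simp [← Complex.ofReal_sin, ← Complex.ofReal_cos]
  rw [← Complex.ofReal_mul, ← Complex.ofReal_mul, ← Complex.ofReal_add, ← sq, ← sq,
    Real.sin_sq_add_cos_sq, Complex.ofReal_one]

section Blocks

open scoped MatrixOrder

lemma exists_eq_conjTranspose_mul_self {n : Type} [Fintype n] {M : Matrix n n ℂ}
    (h : M.PosSemidef) : ∃ K : Matrix n n ℂ, M = Kᴴ * K := by
  classical
  exact CStarAlgebra.nonneg_iff_eq_star_mul_self.mp h.nonneg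

end Blocks

lemma posSemidef_fromBlocks {m n : Type} [Fintype m] [Fintype n] {M : Matrix m m ℂ}
    {N : Matrix n n ℂ} (hM : M.PosSemidef) (hN : N.PosSemidef) :
    (fromBlocks M 0 0 N).PosSemidef := by
  obtain ⟨K, rfl⟩ := exists_eq_conjTranspose_mul_self hM
  obtain ⟨L, rfl⟩ := exists_eq_conjTranspose_mul_self hN
  convert posSemidef_conjTranspose_mul_self (fromBlocks K 0 0 L)
  simp [fromBlocks_conjTranspose, fromBlocks_multiply]

lemma posSemidef_blockDiagonal {m o : Type} [Fintype m] [Fintype o] [DecidableEq o]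
    {M : o → Matrix m m ℂ} (hM : ∀ k, (M k).PosSemidef) : (blockDiagonal M).PosSemidef := by
  choose K hK using fun k => exists_eq_conjTranspose_mul_self (hM k)
  obtain rfl : M = fun k => (K k)ᴴ * K k := funext hK
  convert posSemidef_conjTranspose_mul_self (blockDiagonal K)
  rw [blockDiagonal_conjTranspose, blockDiagonal_mul]

lemma isPOVM_fromBlocks {m n : Type} [Fintype m] [Fintype n] [DecidableEq m] [DecidableEq n]
    {M : Bit → Matrix m m ℂ} {N : Bit → Matrix n n ℂ} (hM : IsPOVM M) (hN : IsPOVM N) :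
    IsPOVM fun o => fromBlocks (M o) 0 0 (N o) := by
  refine ⟨fun o => posSemidef_fromBlocks (hM.1 o) (hN.1 o), ?_⟩
  have h1 := hM.2
  have h2 := hN.2
  rw [Fin.sum_univ_two] at *
  rw [fromBlocks_add, h1, h2, add_zero, add_zero, fromBlocks_one]

lemma isPOVM_blockDiagonal {m o : Type} [Fintype m] [Fintype o] [DecidableEq m] [DecidableEq o]
    {M : o → Bit → Matrix m m ℂ} (hM : ∀ k, IsPOVM (M k)) :
    IsPOVM fun b => blockDiagonal fun k => M k b := by
  refine ⟨fun b => posSemidef_blockDiagonal fun k => (hM k).1 b, ?_⟩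
  rw [Fin.sum_univ_two, ← blockDiagonal_add, ← blockDiagonal_one]
  congr 1
  funext k
  simpa [Fin.sum_univ_two] using (hM k).2

lemma isPOVM_submatrix {m n : Type} [Fintype m] [Fintype n] [DecidableEq m] [DecidableEq n]
    {M : Bit → Matrix m m ℂ} (hM : IsPOVM M) (e : n ≃ m) :
    IsPOVM fun o => (M o).submatrix e e := by
  refine ⟨fun o => (hM.1 o).submatrix e, ?_⟩
  have h := hM.2
  rw [Fin.sum_univ_two] at *
  rw [show (M 0).submatrix e e + (M 1).submatrix e e = (M 0 + M 1).submatrix e e from rfl, h,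
    submatrix_one_equiv]

/-! ### The Born rule for correlated sources -/

/-- The state `∑ R i j |ii⟩⟨jj|`. -/
def correlated {n : Type} [DecidableEq n] (R : Matrix n n ℂ) : Matrix (n × n) (n × n) ℂ :=
  of fun i j => if i.1 = i.2 ∧ j.1 = j.2 then R i.1 j.1 else 0

lemma isState_correlated {n : Type} [Fintype n] [DecidableEq n] {R : Matrix n n ℂ}
    (h : IsState R) : IsState (correlated R) := by
  constructor
  -- The state is the image of `R` under the isometry `|i⟩ ↦ |ii⟩`.
  · convert h.1.mul_mul_conjTranspose_same
      (of fun (i : n × n) (j : n) => if i.1 = i.2 ∧ i.1 = j then (1 : ℂ) else 0)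
    ext i j
    by_cases h1 : i.1 = i.2 <;> by_cases h2 : j.1 = j.2 <;>
      simp [correlated, mul_apply, h1, h2, apply_ite]
  · rw [← h.2]
    simp [correlated, trace, Fintype.sum_prod_type]

lemma bornCorr_correlated {m n : Type} [Fintype m] [DecidableEq m] [Fintype n] [DecidableEq n]
    (R : Matrix m m ℂ) (S : Matrix n n ℂ) (A : Bit → Bit → Matrix m m ℂ)
    (B : Bit → Matrix (m × n) (m × n) ℂ) (C : Bit → Bit → Matrix n n ℂ) (a b c x z : Bit) :
    bornCorr (correlated R) (correlated S) A B C a b c x z =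
      (∑ i, ∑ j, ∑ k, ∑ l, R i j * S k l * (A a x j i * B b (j, l) (i, k) * C c z l k)).re := by
  simp only [bornCorr, trace, diag_apply, mul_apply, Fintype.sum_prod_type, kroneckerMap_apply,
    submatrix_apply, correlated, of_apply, ite_and, ite_mul, mul_ite, zero_mul, mul_zero]
  congr 1
  simp only [Finset.sum_ite_irrel, Finset.sum_const_zero, Finset.sum_ite_eq, Finset.mem_univ,
    if_true]
  exact Finset.sum_congr rfl fun i _ => Finset.sum_comm

lemma ketbra_phiPlus : ketbra phiPlus = correlated (of fun _ _ => (1 / 2 : ℂ)) := by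
  have h := ofReal_one_div_sqrt_two_mul_self
  ext i j
  simp only [ketbra, vecMulVec_apply, phiPlus, Pi.star_apply, correlated, of_apply, apply_ite star,
    RCLike.star_def, Complex.conj_ofReal, star_zero, mul_ite, ite_mul, zero_mul, mul_zero, h,
    ite_and]
  split_ifs <;> rfl

/-- The Born rule for two `|φ⁺⟩` sources. -/
lemma bornCorr_phiPlus (A : Bit → Bit → Matrix Bit Bit ℂ)
    (B : Bit → Matrix (Bit × Bit) (Bit × Bit) ℂ) (C : Bit → Bit → Matrix Bit Bit ℂ)
    (a b c x z : Bit) :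
    bornCorr (ketbra phiPlus) (ketbra phiPlus) A B C a b c x z =
      (∑ i, ∑ j, ∑ k, ∑ l, A a x j i * B b (j, l) (i, k) * C c z l k).re / 4 := by
  rw [ketbra_phiPlus, bornCorr_correlated]
  simp only [of_apply, ← Finset.mul_sum]
  rw [show (1 / 2 : ℂ) * (1 / 2) = ((1 / 4 : ℝ) : ℂ) by norm_num, Complex.re_ofReal_mul]
  ring

lemma pES_eq : pES = pPS (1 / √2) (1 / 4) := by
  have h := one_div_sqrt_two_mul_self
  funext a b c x z
  rw [pES, bornCorr_phiPlus]
  simp only [Fin.sum_univ_two, pPS, prBox, vecMeas, ketbra, obsProj, obsDiag, obsXZ]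
  generalize hr : 1 / √2 = r at *
  fin_cases a <;> fin_cases b <;> fin_cases c <;> fin_cases x <;> fin_cases z <;>
    simp [sigmaX, sigmaZ, psiPlus, vecMulVec_apply, hr, -one_div] <;> simp only [h] <;> ring

set_option maxHeartbeats 1000000 in
lemma pMNN2_eq (θ : ℝ) : pMNN2 θ = tilted (Real.sin θ) (Real.cos θ) := by
  have h := Real.sin_sq_add_cos_sq θ
  funext a b c x z
  rw [pMNN2, bornCorr_phiPlus]
  simp only [Fin.sum_univ_two, tilted, vecMeas, ketbra, obsProj, obsXZ]
  unfold psiTheta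
  generalize Real.sin θ = s at *
  generalize Real.cos θ = k at *
  fin_cases a <;> fin_cases b <;> fin_cases c <;> fin_cases x <;> fin_cases z <;>
    simp [sigmaX, sigmaZ, vecMulVec_apply] <;> linarith

lemma pMNN2_mem_Q2 (θ : ℝ) : pMNN2 θ ∈ Q2 :=
  ⟨Bit, Bit, Bit, Bit, inferInstance, inferInstance, inferInstance, inferInstance, inferInstance,
    inferInstance, inferInstance, inferInstance, ketbra phiPlus, ketbra phiPlus,
    fun a x => obsProj (obsXZ x) a, vecMeas (psiTheta θ), fun c z => obsProj (obsXZ z) c,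
    isState_ketbra phiPlus_norm, isState_ketbra phiPlus_norm, isPOVM_obsProj_obsXZ,
    isPOVM_vecMeas (psiTheta_norm θ), isPOVM_obsProj_obsXZ, rfl⟩

/-! ### Quantum realization of the mixture -/

lemma isPOVM_computational :
    IsPOVM fun c : Bit => diagonal fun k : Bit => if k = c then (1 : ℂ) else 0 := by
  refine ⟨fun c => PosSemidef.diagonal fun k => ?_, ?_⟩
  · dsimp only
    split_ifs <;> simp
  · ext i j
    fin_cases i <;> fin_cases j <;> simp [Fin.sum_univ_two]

/-- With probability `μ` `|φ⁺⟩`, otherwise a shared uniform bit, with a flag telling which. -/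
def flagged (μ : ℝ) : Matrix (Bit ⊕ Bit) (Bit ⊕ Bit) ℂ :=
  fromBlocks (of fun _ _ => ((μ / 2 : ℝ) : ℂ)) 0 0 (diagonal fun _ => (((1 - μ) / 2 : ℝ) : ℂ))

lemma isState_flagged {μ : ℝ} (h0 : 0 ≤ μ) (h1 : μ ≤ 1) : IsState (flagged μ) := by
  constructor
  · refine posSemidef_fromBlocks ?_ (PosSemidef.diagonal fun k => ?_)
    · have h : (0 : ℂ) ≤ ((μ / 2 : ℝ) : ℂ) := by
        rw [Complex.zero_le_real]; positivity
      convert (posSemidef_vecMulVec_self_star (fun _ : Bit => (1 : ℂ))).smul h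
      ext i j
      simp [vecMulVec_apply]
    · rw [Pi.zero_apply, Complex.zero_le_real]
      linarith
  · simp [flagged, trace]
    ring

/-- Under the first flag Bob tests for `|ψ⁺⟩` and Charlie measures `σ_x` or `σ_z`. Under the second
Charlie outputs the shared bit `k`, and Bob uses it to measure `obsDiag k` on his half of Alice's
pair: on `|φ⁺⟩` equal settings agree perfectly, and different ones, being anticommuting, are
uncorrelated. -/
lemma bornCorr_flagged {μ : ℝ} :
    bornCorr (ketbra phiPlus) (correlated (flagged μ)) (fun a x => obsProj (obsDiag x) a)
      (fun b => (fromBlocks (vecMeas psiPlus b) 0 0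
        (blockDiagonal fun k => obsProj (obsDiag k) b)).submatrix
          (Equiv.prodSumDistrib Bit Bit Bit) (Equiv.prodSumDistrib Bit Bit Bit))
      (fun c z => fromBlocks (obsProj (obsXZ z) c) 0 0
        (diagonal fun k => if k = c then (1 : ℂ) else 0)) = pMNN1 μ := by
  have h := one_div_sqrt_two_mul_self
  funext a b c x z
  have hL : (∑ i, ∑ j, obsProj (obsDiag x) a j i * obsProj (obsDiag c) b j i).re / 4 =
      pL a b c x z := by
    simp only [Fin.sum_univ_two, obsProj, obsDiag, pL]
    generalize 1 / √2 = r at *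
    fin_cases a <;> fin_cases b <;> fin_cases c <;> fin_cases x <;>
      simp [sigmaX, sigmaZ] <;> linarith
  rw [pMNN1, Pi.add_apply, Pi.add_apply, Pi.add_apply, Pi.add_apply, Pi.add_apply]
  simp only [Pi.smul_apply, smul_eq_mul]
  rw [← hL, pES, bornCorr_phiPlus, ketbra_phiPlus, bornCorr_correlated]
  simp only [Fintype.sum_sum_type, submatrix_apply, Equiv.prodSumDistrib_apply_left,
    Equiv.prodSumDistrib_apply_right, fromBlocks_apply₁₁, fromBlocks_apply₁₂,
    fromBlocks_apply₂₁, fromBlocks_apply₂₂, flagged, of_apply, Matrix.zero_apply, mul_zero,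
    Finset.sum_const_zero, add_zero, zero_add, diagonal_apply, blockDiagonal_apply]
  simp only [Finset.sum_add_distrib, ite_mul, mul_ite, mul_zero, zero_mul, Finset.sum_ite_eq',
    Finset.mem_univ, if_true, mul_one, ← Finset.mul_sum]
  rw [show (1 / 2 : ℂ) * ((μ / 2 : ℝ) : ℂ) = ((μ / 4 : ℝ) : ℂ) by push_cast; ring,
    show (1 / 2 : ℂ) * (((1 - μ) / 2 : ℝ) : ℂ) = (((1 - μ) / 4 : ℝ) : ℂ) by push_cast; ring,
    Complex.add_re, Complex.re_ofReal_mul, Complex.re_ofReal_mul]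
  ring

lemma pMNN1_mem_Q2 {μ : ℝ} (h0 : 0 ≤ μ) (h1 : μ ≤ 1) : pMNN1 μ ∈ Q2 :=
  ⟨Bit, Bit, Bit ⊕ Bit, Bit ⊕ Bit, inferInstance, inferInstance, inferInstance, inferInstance,
    inferInstance, inferInstance, inferInstance, inferInstance, _, _, _, _, _,
    isState_ketbra phiPlus_norm, isState_correlated (isState_flagged h0 h1),
    isPOVM_obsProj_obsDiag,
    isPOVM_submatrix (isPOVM_fromBlocks (isPOVM_vecMeas psiPlus_norm)
      (isPOVM_blockDiagonal isPOVM_obsProj_obsDiag)) _,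
    fun z => isPOVM_fromBlocks (isPOVM_obsProj_obsXZ z) isPOVM_computational,
    bornCorr_flagged.symm⟩

lemma pMNN2_mem {θ : ℝ}
    (hθ : θ ∈ Set.Ioo (0 : ℝ) (Real.pi / 4) ∪ Set.Ioo (Real.pi / 4) (Real.pi / 2)) :
    pMNN2 θ ∈ Q2 ∩ MNN := by
  refine ⟨pMNN2_mem_Q2 θ, ?_⟩
  have hpi := Real.pi_pos
  have h0 : 0 < θ := by rcases hθ with h | h <;> linarith [h.1]
  have h1 : θ < Real.pi / 2 := by rcases hθ with h | h <;> linarith [h.2]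
  have hs : 0 < Real.sin θ := Real.sin_pos_of_pos_of_lt_pi h0 (by linarith)
  have hc : 0 < Real.cos θ := Real.cos_pos_of_mem_Ioo ⟨by linarith, h1⟩
  have h := Real.sin_sq_add_cos_sq θ
  -- The sine and cosine agree in this range only at the excluded angle `π / 4`.
  have hne : Real.sin θ ≠ Real.cos θ := by
    rw [← Real.sin_pi_div_two_sub]
    intro he
    have := Real.injOn_sin ⟨by linarith, by linarith⟩ ⟨by linarith, by linarith⟩ he
    rcases hθ with h | h <;> linarith [h.1, h.2]
  rw [pMNN2_eq]
  exact ⟨tilted_mem_S1cap hs.le hc.le h, tilted_notMem_S0 hs hc h hne⟩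

lemma pMNN1_mem {μ : ℝ} (hμ : μ ∈ Set.Ioo (0.455 : ℝ) 0.705) : pMNN1 μ ∈ Q2 ∩ MNN := by
  have h0 := hμ.1
  have h1 := hμ.2
  refine ⟨pMNN1_mem_Q2 (by linarith) (by linarith), ?_⟩
  rw [pMNN1, pES_eq]
  exact mixed_mem_MNN h0 h1

end

end ThreeChain

theorem mainTheorem5 :
    (ThreeChain.Q2 ∩ ThreeChain.MNN).Nonempty ∧
    ThreeChain.pES = ThreeChain.pPS (1 / √2) (1 / 4) ∧
    (∀ μ ∈ Set.Ioo (0.455 : ℝ) 0.705, ThreeChain.pMNN1 μ ∈ ThreeChain.Q2 ∩ ThreeChain.MNN) ∧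
    (∀ θ ∈ Set.Ioo (0 : ℝ) (Real.pi / 4) ∪ Set.Ioo (Real.pi / 4) (Real.pi / 2),
      ThreeChain.pMNN2 θ ∈ ThreeChain.Q2 ∩ ThreeChain.MNN) :=
  ⟨⟨_, ThreeChain.pMNN1_mem (μ := 0.5) (by norm_num)⟩, ThreeChain.pES_eq,
    fun _ => ThreeChain.pMNN1_mem, fun _ => ThreeChain.pMNN2_mem⟩
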